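/- Let $n\ge 0$ be an integer. For $h:\mathbb{Z}^n\to\mathbb{R}\cup\{\pm\infty\}$ put $\operatorname{dom}h=\{x\in\mathbb{Z}^n : -\infty<h(x)<+\infty\}$, and let $\langle p,x\rangle=\sum_{i=1}^n p_ix_i$. The integral conjugate of $f:\mathbb{Z}^n\to\mathbb{Z}\cup\{+\infty\}$ with $\operatorname{dom}f\neq\emptyset$ is $f^{\bullet}(p)=\sup\{\langle p,x\rangle-f(x) : x\in\mathbb{Z}^n\}$ $(p\in\mathbb{Z}^n)$, and the integral concave conjugate of $\Psi:\mathbb{Z}^n\to\mathbb{Z}\cup\{-\infty\}$ with $\operatorname{dom}\Psi\neq\emptyset$ is $\Psi^{\circ}(p)=\inf\{\langle p,x\rangle-\Psi(x) : x\in\mathbb{Z}^n\}$ $(p\in\mathbb{Z}^n)$. For $x\in\mathbb{R}^n$ let $N(x)=\{z\in\mathbb{Z}^n : |x_i-z_i|<1\ (i=1,\dots,n)\}$. A function $f:\mathbb{Z}^n\to\mathbb{R}\cup\{+\infty\}$ with $\operatorname{dom}f\neq\emptyset$ is called integrally convex if the function $\tilde f:\mathbb{R}^n\to\mathbb{R}\cup\{+\infty\}$,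 $$\tilde f(x)=\min\Big\{\sum_{y\in N(x)}\lambda_yf(y) : \sum_{y\in N(x)}\lambda_y\,y=x,\ \sum_{y\in N(x)}\lambda_y=1,\ \lambda_y\ge 0\ (y\in N(x))\Big\}$$ (with $0\cdot\infty=0$) is convex on $\mathbb{R}^n$. Let $\mathcal{G}$ be the set of all functions $g=f^{\bullet}$, where $f:\mathbb{Z}^n\to\mathbb{Z}\cup\{+\infty\}$ is an integer-valued integrally convex function (with $\operatorname{dom}f\ne\emptyset$). A function $\Psi:\mathbb{Z}^n\to\mathbb{Z}\cup\{-\infty\}$ is called separable concave if $\Psi(x)=\psi_1(x_1)+\cdots+\psi_n(x_n)$ for functions $\psi_i:\mathbb{Z}\to\mathbb{Z}\cup\{-\infty\}$ such that $\operatorname{dom}\psi_i$ is an interval of integers and $\psi_i(k-1)+\psi_i(k+1)\le 2\psi_i(k)$ for all $k\in\mathbb{Z}$. **Theorem.** Let $g:\mathbb{Z}^n\to\mathbb{Z}\cup\{+\infty\}$ belong to $\mathcal{G}$, with $\operatorname{dom}g\neq\emptyset$, and let $\Psi:\mathbb{Z}^n\to\mathbb{Z}\cup\{-\infty\}$ be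 an integer-valued separable concave function with $\operatorname{dom}\Psi\neq\emptyset$. Suppose that $\inf\{g(x)-\Psi(x) : x\in\mathbb{Z}^n\}$ is finite or $\sup\{\Psi^{\circ}(p)-g^{\bullet}(p) : p\in\mathbb{Z}^n\}$ is finite. Then the infimum and the supremum are both attained, and $$\min\{g(x)-\Psi(x) : x\in\mathbb{Z}^n\}=\max\{\Psi^{\circ}(p)-g^{\bullet}(p) : p\in\mathbb{Z}^n\}\in\mathbb{Z}.$$ -/

import Mathlib

open scoped BigOperators

namespace IntConvex

noncomputable section

/-- The effective domain `{x ∈ ℤⁿ ∣ -∞ < h x < +∞}` of an extended-real-valued function. -/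
def effDom {α : Type*} (h : α → EReal) : Set α := {x | ⊥ < h x ∧ h x < ⊤}

/-- `f` takes its values in `ℤ ∪ {+∞}`. -/
def IsIntOrTop {α : Type*} (f : α → EReal) : Prop :=
  ∀ x, f x = ⊤ ∨ ∃ k : ℤ, f x = ((k : ℝ) : EReal)

/-- `f` takes its values in `ℤ ∪ {-∞}`. -/
def IsIntOrBot {α : Type*} (f : α → EReal) : Prop :=
  ∀ x, f x = ⊥ ∨ ∃ k : ℤ, f x = ((k : ℝ) : EReal)

/-- The inner product `⟨p, x⟩ = ∑ i, p i * x i` of two integer vectors, as an extended real. -/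
def pairing {n : ℕ} (p x : Fin n → ℤ) : EReal := ((∑ i, p i * x i : ℤ) : ℝ)

/-- The integral (convex) conjugate `f•(p) = sup {⟨p, x⟩ - f x ∣ x ∈ ℤⁿ}`. -/
def conj {n : ℕ} (f : (Fin n → ℤ) → EReal) (p : Fin n → ℤ) : EReal :=
  ⨆ x : Fin n → ℤ, (pairing p x - f x)

/-- The integral concave conjugate `h°(p) = inf {⟨p, x⟩ - h x ∣ x ∈ ℤⁿ}`. -/
def concaveConj {n : ℕ} (h : (Fin n → ℤ) → EReal) (p : Fin n → ℤ) : EReal :=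
  ⨅ x : Fin n → ℤ, (pairing p x - h x)

/-- The integral neighborhood `N(x) = {z ∈ ℤⁿ ∣ ⌊x i⌋ ≤ z i ≤ ⌈x i⌉ for all i}` of `x ∈ ℝⁿ`,
a finite set; `mem_nbhd` gives the description by `|x i - z i| < 1`. -/
def nbhd {n : ℕ} (x : Fin n → ℝ) : Finset (Fin n → ℤ) :=
  Finset.Icc (fun i => ⌊x i⌋) (fun i => ⌈x i⌉)

theorem mem_nbhd {n : ℕ} (x : Fin n → ℝ) (z : Fin n → ℤ) :
    z ∈ nbhd x ↔ ∀ i, |x i - (z i : ℝ)| < 1 := by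
  simp only [nbhd, Finset.mem_Icc, Pi.le_def, ← forall_and]
  refine forall_congr' fun i => ?_
  rw [abs_lt, ← Int.lt_add_one_iff, Int.floor_lt, ← Int.sub_one_lt_iff, Int.lt_ceil]
  push_cast
  constructor
  · rintro ⟨h1, h2⟩
    constructor <;> linarith
  · rintro ⟨h1, h2⟩
    constructor <;> linarith

/-- `c` is a family of coefficients of a convex combination of the points of `N(x)` that
represents `x`. -/
def IsLocalWeight {n : ℕ} (x : Fin n → ℝ) (c : (Fin n → ℤ) → ℝ) : Prop :=
  (∀ y ∈ nbhd x, 0 ≤ c y) ∧ ∑ y ∈ nbhd x, c y = 1 ∧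
    ∀ i, ∑ y ∈ nbhd x, c y * (y i : ℝ) = x i

/-- The local convex extension `f̃` of `f`: the least value of `∑ y ∈ N(x), c y * f y` over the
representations of `x` as a convex combination of the points of `N(x)` (with `0 * ∞ = 0`). -/
def localConvexExt {n : ℕ} (f : (Fin n → ℤ) → EReal) (x : Fin n → ℝ) : EReal :=
  sInf {v : EReal | ∃ c : (Fin n → ℤ) → ℝ, IsLocalWeight x c ∧
    v = ∑ y ∈ nbhd x, (c y : EReal) * f y}

/-- Convexity of a function `ℝⁿ → ℝ ∪ {+∞}` (with `0 * ∞ = 0`). -/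
def IsConvexFn {n : ℕ} (F : (Fin n → ℝ) → EReal) : Prop :=
  ∀ (x y : Fin n → ℝ) (a b : ℝ), 0 ≤ a → 0 ≤ b → a + b = 1 →
    F (a • x + b • y) ≤ (a : EReal) * F x + (b : EReal) * F y

/-- `f : ℤⁿ → ℝ ∪ {+∞}` with nonempty effective domain is integrally convex:
its local convex extension is convex on `ℝⁿ`. -/
structure IsIntegrallyConvex {n : ℕ} (f : (Fin n → ℤ) → EReal) : Prop where
  ne_bot : ∀ x, f x ≠ ⊥
  dom_nonempty : (effDom f).Nonempty
  convex : IsConvexFn (localConvexExt f)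

/-- The class `𝒢` of integral conjugates of integer-valued integrally convex functions. -/
def conjClass (n : ℕ) : Set ((Fin n → ℤ) → EReal) :=
  {g | ∃ f : (Fin n → ℤ) → EReal, IsIntOrTop f ∧ IsIntegrallyConvex f ∧ g = conj f}

/-- `ψ : ℤ → ℤ ∪ {-∞}` is a univariate discrete concave function. -/
structure IsUnivariateConcave (ψ : ℤ → EReal) : Prop where
  int_valued : IsIntOrBot ψ
  dom_interval : (effDom ψ).OrdConnected
  concave : ∀ k : ℤ, ψ (k - 1) + ψ (k + 1) ≤ 2 * ψ k

/-- `Ψ : ℤⁿ → ℤ ∪ {-∞}` is an integer-valued separable concave function. -/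
def IsSeparableConcave {n : ℕ} (Ψ : (Fin n → ℤ) → EReal) : Prop :=
  ∃ ψ : Fin n → ℤ → EReal, (∀ i, IsUnivariateConcave (ψ i)) ∧ ∀ x, Ψ x = ∑ i, ψ i (x i)

/-- The extended real number `a` is finite. -/
def IsFinite (a : EReal) : Prop := a ≠ ⊥ ∧ a ≠ ⊤

end

end IntConvex

/-! Biconjugacy turns the dual objective into Ψ° - f, where g = f•. By weak duality it then suffices
to find a certificate (`IsDualPair`): an integral subgradient x of f at some q in dom f such that
each x i minimizes q i * t - ψ i t.

If the dual is feasible and bounded, integrality provides a maximizer q. The required x must lie in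
the box of coordinatewise argmins and in the subdifferential of f at q. Integral convexity makes
that subdifferential the solution set of inequalities with directions in {-1, 0, 1}ⁿ, and makes this
system closed under discrete midpoints. Fourier-Motzkin elimination then never creates larger
coefficients and stays integral (`exists_integral_solution`). It remains to check each inequality
separately against the box. This is the optimality of q against its neighbours q + y, because a
minimizer extreme in direction -y remains a minimizer after q is moved to q + y.

If a primal minimizer x is given instead, restricting Ψ to the unit box around x makes the dual
feasible and bounded (`exists_isDualPair_of_minimizer`). The case of linear Ψ yields biconjugacy
itself. -/

open scoped BigOperators

namespace IntConvex

/-! ### Integral Fourier-Motzkin elimination -/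

/-- Helly's theorem for an interval of integers and finitely many half-lines. -/
theorem exists_mem_between {M L U : Set ℤ} (hM : M.OrdConnected) (hne : M.Nonempty)
    (hL : L.Finite) (hU : U.Finite) (hLU : ∀ l ∈ L, ∀ u ∈ U, l ≤ u)
    (hLM : ∀ l ∈ L, ∃ t ∈ M, l ≤ t) (hUM : ∀ u ∈ U, ∃ t ∈ M, t ≤ u) :
    ∃ t ∈ M, (∀ l ∈ L, l ≤ t) ∧ ∀ u ∈ U, t ≤ u := by
  obtain ⟨b, hb, hbL⟩ : ∃ b ∈ M, ∀ l ∈ L, l ≤ b := by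
    rcases L.eq_empty_or_nonempty with rfl | hLne
    · exact ⟨hne.some, hne.some_mem, by simp⟩
    · obtain ⟨l, hl, hmax⟩ := Set.exists_max_image L id hL hLne
      obtain ⟨t, ht, hlt⟩ := hLM l hl
      exact ⟨t, ht, fun l' hl' => (hmax l' hl').trans hlt⟩
  rcases U.eq_empty_or_nonempty with rfl | hUne
  · exact ⟨b, hb, hbL, by simp⟩
  · obtain ⟨u, hu, hmin⟩ := Set.exists_min_image U id hU hUne
    obtain ⟨t, ht, htu⟩ := hUM u hu
    rcases le_or_gt b u with h | h
    · exact ⟨b, hb, hbL, fun u' hu' => h.trans (hmin u' hu')⟩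
    · exact ⟨u, hM.out ht hb ⟨htu, h.le⟩, fun l hl => hLU l hl u hu, hmin⟩

/-- A finite system of inequalities `⟨x, y⟩ ≤ k` with `y ∈ {-1, 0, 1}ⁿ` that is closed under
discrete midpoints, and that is compatible with each of the corners of the box `∏ M i`, has an
integral solution in that box (by Fourier-Motzkin elimination). -/
theorem exists_integral_solution {n : ℕ} (M : Fin n → Set ℤ)
    (hM : ∀ i, (M i).OrdConnected) (hne : ∀ i, (M i).Nonempty)
    (C : Set ((Fin n → ℤ) × ℤ)) (hfin : C.Finite) (hbox : ∀ c ∈ C, ∀ i, |c.1 i| ≤ 1)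
    (hmid : ∀ c ∈ C, ∀ d ∈ C, ∀ p : Fin n → ℤ,
      (∀ e ∈ C, (∀ i, |2 * e.1 i - (c.1 i + d.1 i)| ≤ 1) → ∑ i, p i * e.1 i ≤ e.2) →
      ∑ i, p i * (c.1 i + d.1 i) ≤ c.2 + d.2)
    (hfeas : ∀ c ∈ C, ∀ m : Fin n → ℤ,
      (∀ i, IsLeast ((fun t => t * c.1 i) '' M i) (m i)) → ∑ i, m i ≤ c.2) :
    ∃ x : Fin n → ℤ, (∀ i, x i ∈ M i) ∧ ∀ c ∈ C, ∑ i, x i * c.1 i ≤ c.2 := by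
  induction n with
  | zero =>
    exact ⟨Fin.elim0, fun i => i.elim0, fun c hc => by
      simpa using hfeas c hc (fun i => i.elim0) (fun i => i.elim0)⟩
  | succ n ih =>
    -- The projected system replaces the term in coordinate 0 by its minimum over `M 0`, and drops
    -- the inequality if there is no minimum. The usual sums of an upper and a lower bound are not
    -- added: midpoint closure implies them.
    set C' : Set ((Fin n → ℤ) × ℤ) := {c | ∃ s m : ℤ,
      IsLeast ((fun t => t * s) '' M 0) m ∧
        ((Fin.cons s c.1 : Fin (n + 1) → ℤ), c.2 + m) ∈ C} with hC'
    have hzero : IsLeast ((fun t => t * 0) '' M 0) 0 := by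
      obtain ⟨t, ht⟩ := hne 0
      exact ⟨⟨t, ht, by simp⟩, by rintro _ ⟨t, -, rfl⟩; simp⟩
    have hfin' : C'.Finite := by
      refine (hfin.image fun e : (Fin (n + 1) → ℤ) × ℤ =>
        ((Fin.tail e.1 : Fin n → ℤ), e.2 - sInf ((fun t => t * e.1 0) '' M 0))).subset ?_
      rintro ⟨y, k⟩ ⟨s, m, hm, hc⟩
      refine ⟨_, hc, ?_⟩
      simp only [Fin.tail_cons, Fin.cons_zero, hm.csInf_eq, add_sub_cancel_right]
    obtain ⟨x, hxM, hx⟩ := ih (fun i => M i.succ) (fun i => hM _) (fun i => hne _) C' hfin'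
      (by
        rintro ⟨y, k⟩ ⟨s, m, -, hc⟩ i
        simpa using hbox _ hc i.succ)
      (by
        rintro ⟨y, k⟩ ⟨s, m, hm, hc⟩ ⟨z, l⟩ ⟨t, m', hm', hd⟩ p hp
        obtain ⟨⟨r, hr, rfl⟩, hrl⟩ := hm
        obtain ⟨⟨r', hr', rfl⟩, hrl'⟩ := hm'
        have hs := hbox _ hc 0
        have ht := hbox _ hd 0
        simp only [Fin.cons_zero] at hs ht hp hrl hrl'
        have h1 : ∀ a ∈ M 0, r * s ≤ a * s := fun a ha => hrl ⟨a, ha, rfl⟩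
        have h2 : ∀ a ∈ M 0, r' * t ≤ a * t := fun a ha => hrl' ⟨a, ha, rfl⟩
        have hs' : s = -1 ∨ s = 0 ∨ s = 1 := by rw [abs_le] at hs; omega
        have ht' : t = -1 ∨ t = 0 ∨ t = 1 := by rw [abs_le] at ht; omega
        -- One value of coordinate 0 must be optimal for all rounded midpoints `w` of `s` and `t` at
        -- once. If `s = t` or one of them is 0, a minimizer for a nonzero one serves; if `s = -t`,
        -- only `w = 0` occurs and any value does.
        obtain ⟨q, hq, hqle, hqmin⟩ : ∃ q ∈ M 0, r * s + r' * t ≤ q * (s + t) ∧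
            ∀ w : ℤ, |2 * w - (s + t)| ≤ 1 → ∀ a ∈ M 0, q * w ≤ a * w := by
          have h3 := h1 _ hr'
          have h4 := h2 _ hr
          refine ⟨if s = 0 then r' else r, by split_ifs <;> assumption, ?_, ?_⟩
          · rcases hs' with rfl | rfl | rfl <;> rcases ht' with rfl | rfl | rfl <;> simp <;>
              linarith
          · intro w hw a ha
            have h5 := h1 a ha
            have h6 := h2 a ha
            rw [abs_le] at hw
            rcases hs' with rfl | rfl | rfl <;> rcases ht' with rfl | rfl | rfl <;>
              have hw' : w = -1 ∨ w = 0 ∨ w = 1 := by omega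
            all_goals
              rcases hw' with rfl | rfl | rfl <;> simp <;> omega
        have := hmid _ hc _ hd (Fin.cons q p) (by
          rintro ⟨e, k'⟩ he hw
          rw [← Fin.cons_self_tail e] at he hw ⊢
          have := hp (Fin.tail e, k' - q * e 0) ⟨e 0, q * e 0,
            ⟨⟨q, hq, rfl⟩, by
              rintro _ ⟨a, ha, rfl⟩
              exact hqmin _ (by simpa using hw 0) a ha⟩, by simpa using he⟩
            (fun i => by simpa using hw i.succ)
          simp only [Fin.sum_univ_succ, Fin.cons_zero, Fin.cons_succ] at this ⊢
          linarith)
        simp only [Fin.sum_univ_succ, Fin.cons_zero, Fin.cons_succ] at this ⊢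
        linarith)
      (by
        rintro ⟨y, k⟩ ⟨s, m, hm, hc⟩ m' hm'
        have := hfeas _ hc (Fin.cons m m') (fun i => by
          refine Fin.cases ?_ (fun i => ?_) i
          · simpa using hm
          · simpa using hm' i)
        simp only [Fin.sum_univ_succ, Fin.cons_zero, Fin.cons_succ] at this ⊢
        linarith)
    obtain ⟨t, htM, htL, htU⟩ := exists_mem_between (M := M 0)
      (L := (fun e : (Fin (n + 1) → ℤ) × ℤ => ∑ i, x i * e.1 i.succ - e.2) ''
        {e ∈ C | e.1 0 = -1})
      (U := (fun e : (Fin (n + 1) → ℤ) × ℤ => e.2 - ∑ i, x i * e.1 i.succ) ''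
        {e ∈ C | e.1 0 = 1})
      (hM 0) (hne 0) ((hfin.subset (Set.sep_subset _ _)).image _)
      ((hfin.subset (Set.sep_subset _ _)).image _)
      (by
        rintro _ ⟨d, ⟨hd, hd0⟩, rfl⟩ _ ⟨c, ⟨hc, hc0⟩, rfl⟩
        -- Midpoints of coefficients 1 and -1 have coefficient 0, so the value put in coordinate 0
        -- is immaterial and the projected system applies.
        have := hmid c hc d hd (Fin.cons 0 x) (by
          rintro ⟨e, k⟩ he hw
          have h0 : e 0 = 0 := by
            have := hw 0
            rw [hc0, hd0, abs_le] at this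
            simp only at this
            omega
          rw [← Fin.cons_self_tail e, h0] at he
          have := hx (Fin.tail e, k) ⟨0, 0, hzero, by simpa using he⟩
          simpa [Fin.sum_univ_succ, Fin.tail] using this)
        simp only [Fin.sum_univ_succ, Fin.cons_zero, Fin.cons_succ, mul_add,
          Finset.sum_add_distrib] at this
        linarith)
      (by
        rintro _ ⟨⟨d, k⟩, ⟨hd, hd0⟩, rfl⟩
        by_contra! hcon
        simp only at hd0 hcon
        -- A violated lower bound would bound `M 0` above; its greatest element `b` then puts this
        -- very inequality into `C'`, a contradiction.
        obtain ⟨b, hb, hbmax⟩ := Int.exists_greatest_of_bdd (P := (· ∈ M 0))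
          ⟨_, fun z hz => (hcon z hz).le⟩ (hne 0)
        rw [← Fin.cons_self_tail d, hd0] at hd
        have := hx (Fin.tail d, k + b) ⟨-1, -b, ⟨⟨b, hb, by simp⟩, by
          rintro _ ⟨a, ha, rfl⟩
          have := hbmax a ha
          simp only
          linarith⟩, by simpa using hd⟩
        have h2 := hcon b hb
        simp only [Fin.tail] at this
        linarith)
      (by
        rintro _ ⟨⟨d, k⟩, ⟨hd, hd0⟩, rfl⟩
        by_contra! hcon
        simp only at hd0 hcon
        obtain ⟨b, hb, hbmin⟩ := Int.exists_least_of_bdd (P := (· ∈ M 0))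
          ⟨_, fun z hz => (hcon z hz).le⟩ (hne 0)
        rw [← Fin.cons_self_tail d, hd0] at hd
        have := hx (Fin.tail d, k - b) ⟨1, b, ⟨⟨b, hb, by simp⟩, by
          rintro _ ⟨a, ha, rfl⟩
          have := hbmin a ha
          simp only
          linarith⟩, by simpa using hd⟩
        have h2 := hcon b hb
        simp only [Fin.tail] at this
        linarith)
    refine ⟨Fin.cons t x, fun i => Fin.cases (by simpa) (fun i => by simpa using hxM i) i, ?_⟩
    rintro ⟨e, k⟩ he
    have h0 := hbox _ he 0
    simp only [abs_le] at h0
    rcases (by omega : e 0 = -1 ∨ e 0 = 0 ∨ e 0 = 1) with h | h | h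
    · have := htL _ ⟨_, ⟨he, h⟩, rfl⟩
      simp only [Fin.sum_univ_succ, Fin.cons_zero, Fin.cons_succ, h] at this ⊢
      linarith
    · rw [← Fin.cons_self_tail e, h] at he
      have := hx (Fin.tail e, k) ⟨0, 0, hzero, by simpa using he⟩
      simpa [Fin.sum_univ_succ, Fin.tail, h] using this
    · have := htU _ ⟨_, ⟨he, h⟩, rfl⟩
      simp only [Fin.sum_univ_succ, Fin.cons_zero, Fin.cons_succ, h] at this ⊢
      linarith

/-! ### Convex functions on intervals of integers -/

/-- Convexity of an integer-valued function on an interval of integers. -/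
structure ConvexOnInterval (S : Set ℤ) (u : ℤ → ℤ) : Prop where
  ordConnected : S.OrdConnected
  midpoint : ∀ k, k - 1 ∈ S → k + 1 ∈ S → 2 * u k ≤ u (k - 1) + u (k + 1)

/-- The set of minimizers of `u` on `S`. -/
def argmin (S : Set ℤ) (u : ℤ → ℤ) : Set ℤ := {t ∈ S | ∀ a ∈ S, u t ≤ u a}

namespace ConvexOnInterval

variable {S : Set ℤ} {u : ℤ → ℤ}

theorem comp_neg (h : ConvexOnInterval S u) :
    ConvexOnInterval {t | -t ∈ S} (fun t => u (-t)) where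
  ordConnected := ⟨fun a ha b hb t ht => h.ordConnected.out hb ha
    ⟨neg_le_neg ht.2, neg_le_neg ht.1⟩⟩
  midpoint k hk hk' := by
    have := h.midpoint (-k) (by simpa [add_comm, sub_eq_add_neg] using hk')
      (by simpa [add_comm, sub_eq_add_neg] using hk)
    rw [show -(k - 1) = -k + 1 by ring, show -(k + 1) = -k - 1 by ring]
    linarith

theorem add_linear (h : ConvexOnInterval S u) (d : ℤ) :
    ConvexOnInterval S (fun t => u t + d * t) where
  ordConnected := h.ordConnected
  midpoint k hk hk' := by
    have := h.midpoint k hk hk'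
    linarith

theorem mono (h : ConvexOnInterval S u) {T : Set ℤ} (hT : T.OrdConnected) (hTS : T ⊆ S) :
    ConvexOnInterval T u :=
  ⟨hT, fun k hk hk' => h.midpoint k (hTS hk) (hTS hk')⟩

/-- The slopes of a convex function increase to the right. -/
theorem right_slope (h : ConvexOnInterval S u) {a c d : ℤ} (ha : a ∈ S) (hc : c ∈ S)
    (hac : a ≤ c) (hd : a + 1 ∈ S → u a + d ≤ u (a + 1)) : u a + d * (c - a) ≤ u c := by
  -- The induction must also carry the bound on the next slope.
  suffices H : c ∈ S → u a + d * (c - a) ≤ u c ∧ (c + 1 ∈ S → u c + d ≤ u (c + 1)) from (H hc).1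
  clear hc
  induction c, hac using Int.leInduction with
  | base => exact fun _ => ⟨by simp, hd⟩
  | succ c hac ih =>
    intro hc
    obtain ⟨h1, h2⟩ := ih (h.ordConnected.out ha hc ⟨hac, by omega⟩)
    have h3 := h2 hc
    refine ⟨by linarith, fun hc2 => ?_⟩
    have := h.midpoint (c + 1)
      (by simpa using h.ordConnected.out ha hc ⟨hac, by omega⟩) hc2
    rw [add_sub_cancel_right] at this
    linarith

/-- The slopes of a convex function decrease to the left. -/
theorem left_slope (h : ConvexOnInterval S u) {a c d : ℤ} (ha : a ∈ S) (hc : c ∈ S)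
    (hca : c ≤ a) (hd : a - 1 ∈ S → u a + d ≤ u (a - 1)) : u a + d * (a - c) ≤ u c := by
  have := h.comp_neg.right_slope (a := -a) (c := -c) (d := d) (by simpa) (by simpa) (by simpa)
    (by simpa [add_comm, ← sub_eq_add_neg] using hd)
  simp only [neg_neg] at this
  linarith

theorem mem_argmin (h : ConvexOnInterval S u) {a : ℤ} (ha : a ∈ S)
    (h1 : a + 1 ∈ S → u a ≤ u (a + 1)) (h2 : a - 1 ∈ S → u a ≤ u (a - 1)) : a ∈ argmin S u := by
  refine ⟨ha, fun c hc => ?_⟩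
  rcases le_total a c with hac | hac
  · simpa using h.right_slope (d := 0) ha hc hac (by simpa using h1)
  · simpa using h.left_slope (d := 0) ha hc hac (by simpa using h2)

theorem ordConnected_argmin (h : ConvexOnInterval S u) : (argmin S u).OrdConnected := by
  refine ⟨fun a ha c hc b hb => ?_⟩
  obtain ⟨hab, hbc⟩ := hb
  induction b, hab using Int.leInduction with
  | base => exact ha
  | succ b hab ih =>
    have hbM := ih (by omega)
    have hb1 : b + 1 ∈ S := h.ordConnected.out ha.1 hc.1 ⟨by omega, hbc⟩
    refine ⟨hb1, fun t ht => ?_⟩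
    by_contra! hlt
    -- By integrality, leaving the argmin costs at least 1 per step, so `c` could not be a
    -- minimizer.
    have := h.right_slope (d := 1) hbM.1 hc.1 (by omega) (fun _ => by
      have := hbM.2 t ht
      omega)
    have := hc.2 b hbM.1
    omega

/-- The extreme minimizer of `u` in the direction `-s`, where `s ∈ {-1, 0, 1}`, also minimizes
`u t + s * t`. -/
theorem mem_argmin_add_linear (h : ConvexOnInterval S u) {r s : ℤ} (hs : |s| ≤ 1)
    (hr : r ∈ argmin S u) (hrs : ∀ t ∈ argmin S u, r * s ≤ t * s) :
    r ∈ argmin S (fun t => u t + s * t) := by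
  rw [abs_le] at hs
  refine (h.add_linear s).mem_argmin hr.1 (fun h1 => ?_) (fun h1 => ?_)
  · have h2 := hr.2 _ h1
    -- Either `r + 1` is also a minimizer, and extremality of `r` gives `0 ≤ s`, or `u` increases by
    -- at least 1, which absorbs `s ≥ -1`.
    rcases h2.eq_or_lt with h3 | h3
    · have := hrs (r + 1) ⟨h1, fun a ha => h3 ▸ hr.2 a ha⟩
      linarith
    · linarith
  · have h2 := hr.2 _ h1
    rcases h2.eq_or_lt with h3 | h3
    · have := hrs (r - 1) ⟨h1, fun a ha => h3 ▸ hr.2 a ha⟩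
      linarith
    · linarith

end ConvexOnInterval

/-! ### Existence of dual pairs -/

/-- The two consequences of integral convexity that are needed for an integer-valued function `f`
with effective domain `F`: a discrete midpoint inequality, and the passage from local to global
subgradients. -/
structure IsMidpointConvex {n : ℕ} (F : Set (Fin n → ℤ)) (f : (Fin n → ℤ) → ℤ) : Prop where
  midpoint : ∀ y ∈ F, ∀ z ∈ F, ∀ (p : Fin n → ℤ) (b : ℤ),
    (∀ w ∈ F, (∀ i, |2 * w i - (y i + z i)| ≤ 1) → b + ∑ i, p i * w i ≤ f w) →
    2 * b + ∑ i, p i * (y i + z i) ≤ f y + f z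
  global : ∀ q ∈ F, ∀ p : Fin n → ℤ,
    (∀ w ∈ F, (∀ i, |w i - q i| ≤ 1) → f q + ∑ i, p i * (w i - q i) ≤ f w) →
    ∀ w ∈ F, f q + ∑ i, p i * (w i - q i) ≤ f w

/-- `x` is a subgradient at `q` of the function `f` with effective domain `F`, and each `x i`
minimizes `q i * t - v i t` on `S i`. -/
structure IsDualPair {n : ℕ} (F : Set (Fin n → ℤ)) (f : (Fin n → ℤ) → ℤ) (S : Fin n → Set ℤ)
    (v : Fin n → ℤ → ℤ) (q x : Fin n → ℤ) : Prop where
  mem : q ∈ F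
  mem_argmin : ∀ i, x i ∈ argmin (S i) (fun t => q i * t - v i t)
  subgradient : ∀ w ∈ F, f q + ∑ i, x i * (w i - q i) ≤ f w

section

variable {n : ℕ} {F : Set (Fin n → ℤ)} {f : (Fin n → ℤ) → ℤ} {S : Fin n → Set ℤ}
  {v : Fin n → ℤ → ℤ}

theorem convexOnInterval_sub (hS : ∀ i, ConvexOnInterval (S i) (fun t => - v i t)) (i : Fin n)
    (d : ℤ) : ConvexOnInterval (S i) (fun t => d * t - v i t) := by
  convert (hS i).add_linear d using 2
  ring

/-- If the dual problem is feasible and bounded, there is a pair of optimal solutions. -/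
theorem exists_isDualPair_of_bounded (hf : IsMidpointConvex F f)
    (hS : ∀ i, ConvexOnInterval (S i) (fun t => - v i t))
    (hfeas : ∃ q ∈ F, ∀ i, (argmin (S i) (fun t => q i * t - v i t)).Nonempty)
    (B : ℤ) (hB : ∀ q ∈ F, ∀ x : Fin n → ℤ, (∀ i, x i ∈ argmin (S i) (fun t => q i * t - v i t)) →
      ∑ i, (q i * x i - v i (x i)) - f q ≤ B) :
    ∃ q x, IsDualPair F f S v q x := by
  obtain ⟨m, ⟨q, hq, a, ha, rfl⟩, hmax⟩ := Int.exists_greatest_of_bdd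
    (P := fun m => ∃ q ∈ F, ∃ x : Fin n → ℤ,
      (∀ i, x i ∈ argmin (S i) (fun t => q i * t - v i t)) ∧
      m = ∑ i, (q i * x i - v i (x i)) - f q)
    ⟨B, by rintro _ ⟨q, hq, x, hx, rfl⟩; exact hB q hq x hx⟩
    (by
      obtain ⟨q, hq, h⟩ := hfeas
      choose x hx using h
      exact ⟨_, q, hq, x, hx, rfl⟩)
  have hconv := fun i => convexOnInterval_sub hS i (q i)
  -- The subgradient inequalities at `q` in the directions of {-1, 0, 1}ⁿ.
  set C : Set ((Fin n → ℤ) × ℤ) :=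
    {c | (∀ i, |c.1 i| ≤ 1) ∧ q + c.1 ∈ F ∧ c.2 = f (q + c.1) - f q} with hC
  have hfin : C.Finite := by
    refine ((Set.finite_Icc (-1 : Fin n → ℤ) 1).image
      fun y => (y, f (q + y) - f q)).subset ?_
    rintro ⟨y, k⟩ ⟨h1, -, h2⟩
    refine ⟨y, ⟨fun i => (abs_le.1 (h1 i)).1, fun i => (abs_le.1 (h1 i)).2⟩, ?_⟩
    simp only at h2
    rw [h2]
  obtain ⟨x, hxM, hx⟩ := exists_integral_solution
    (fun i => argmin (S i) (fun t => q i * t - v i t))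
    (fun i => (hconv i).ordConnected_argmin) (fun i => ⟨_, ha i⟩) C hfin (fun c hc => hc.1)
    (by
      rintro ⟨y, k⟩ ⟨hy, hyF, hk⟩ ⟨z, l⟩ ⟨hz, hzF, hl⟩ p hp
      simp only at hy hyF hk hz hzF hl hp ⊢
      subst hk hl
      have := hf.midpoint _ hyF _ hzF p (f q - ∑ i, p i * q i) (by
        intro w hw hwi
        have hwi' : ∀ i, |2 * (w - q) i - (y i + z i)| ≤ 1 := fun i => by
          convert hwi i using 2
          simp only [Pi.sub_apply, Pi.add_apply]
          ring
        have := hp (w - q, f w - f q) ⟨fun i => by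
            have h1 := hwi' i
            have h2 := hy i
            have h3 := hz i
            simp only [abs_le] at h1 h2 h3 ⊢
            omega, by simpa using hw, by simp⟩ hwi'
        simp only [Pi.sub_apply, mul_sub, Finset.sum_sub_distrib] at this
        linarith)
      simp only [Pi.add_apply, mul_add, Finset.sum_add_distrib] at this ⊢
      linarith)
    (by
      rintro ⟨y, k⟩ ⟨hy, hyF, hk⟩ m hm
      simp only at hy hyF hk hm ⊢
      subst hk
      -- The extreme minimizers `r` are optimal for both `q` and `q + y`, so the separable part of
      -- the dual objective changes by exactly `∑ i, m i`. Maximality of `q` bounds this by `f (q +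
      -- y) - f q`.
      have hr : ∀ i, ∃ r ∈ argmin (S i) (fun t => q i * t - v i t), r * y i = m i ∧
          r ∈ argmin (S i) (fun t => (q i + y i) * t - v i t) := by
        intro i
        obtain ⟨⟨r, hr, hrm⟩, hle⟩ := hm i
        refine ⟨r, hr, hrm, ?_⟩
        convert (hconv i).mem_argmin_add_linear (hy i) hr (fun t ht => ?_) using 2
        · ring_nf
        · exact hrm.le.trans (hle ⟨t, ht, rfl⟩)
      choose r hr hrm hr' using hr
      have h1 := hmax _ ⟨q + y, hyF, r, hr', rfl⟩
      have h2 : ∑ i, (q i * r i - v i (r i)) = ∑ i, (q i * a i - v i (a i)) :=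
        Finset.sum_congr rfl fun i _ =>
          le_antisymm ((hr i).2 _ (ha i).1) ((ha i).2 _ (hr i).1)
      have h3 : ∑ i, ((q + y) i * r i - v i (r i)) =
          ∑ i, (q i * r i - v i (r i)) + ∑ i, m i := by
        rw [← Finset.sum_add_distrib]
        refine Finset.sum_congr rfl fun i _ => ?_
        rw [← hrm, Pi.add_apply]
        ring
      linarith)
  refine ⟨q, x, hq, hxM, hf.global q hq x fun w hw hwq => ?_⟩
  have := hx (w - q, f w - f q) ⟨hwq, by simpa using hw, by simp⟩
  simp only [Pi.sub_apply] at this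
  linarith

/-- If `x` is an optimal solution of the primal problem with a finite optimal value, then it
belongs to a pair of optimal solutions. -/
theorem exists_isDualPair_of_minimizer (hf : IsMidpointConvex F f) (hF : F.Nonempty)
    (hS : ∀ i, ConvexOnInterval (S i) (fun t => - v i t)) {x : Fin n → ℤ} (hx : ∀ i, x i ∈ S i)
    {c : ℤ} (hc : ∀ q ∈ F, ∑ i, x i * q i - f q ≤ c)
    (hmin : ∀ y : Fin n → ℤ, (∀ i, y i ∈ S i) → ∀ d : ℤ, (∀ q ∈ F, ∑ i, y i * q i - f q ≤ d) →
      c - ∑ i, v i (x i) ≤ d - ∑ i, v i (y i)) :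
    ∃ q, IsDualPair F f S v q x := by
  -- On a finite box every argmin is nonempty, and weak duality at `x` bounds the dual. Radius 1 is
  -- enough, since local minimality of a convex function is global.
  set T : Fin n → Set ℤ := fun i => S i ∩ Set.Icc (x i - 1) (x i + 1) with hT
  have hxT : ∀ i, x i ∈ T i := fun i => ⟨hx i, by simp⟩
  have hTS : ∀ i, ConvexOnInterval (T i) (fun t => - v i t) := fun i =>
    (hS i).mono ((hS i).ordConnected.inter Set.ordConnected_Icc) Set.inter_subset_left
  obtain ⟨q, y, hqy⟩ := exists_isDualPair_of_bounded hf hTS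
    (by
      obtain ⟨q, hq⟩ := hF
      refine ⟨q, hq, fun i => ?_⟩
      obtain ⟨t, ht, htmin⟩ := Set.exists_min_image (T i) (fun t => q i * t - v i t)
        ((Set.finite_Icc _ _).subset Set.inter_subset_right) ⟨_, hxT i⟩
      exact ⟨t, ht, htmin⟩)
    (c - ∑ i, v i (x i))
    (by
      intro q hq y hy
      have h1 : ∑ i, (q i * y i - v i (y i)) ≤ ∑ i, (q i * x i - v i (x i)) :=
        Finset.sum_le_sum fun i _ => (hy i).2 _ (hxT i)
      have h2 := hc q hq
      simp only [Finset.sum_sub_distrib, mul_comm (q _)] at h1 ⊢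
      linarith)
  have hle : ∀ i ∈ Finset.univ, q i * y i - v i (y i) ≤ q i * x i - v i (x i) :=
    fun i _ => (hqy.mem_argmin i).2 _ (hxT i)
  have h1 := hmin y (fun i => (hqy.mem_argmin i).1.1) (∑ i, y i * q i - f q) fun w hw => by
    have := hqy.subgradient w hw
    simp only [mul_sub, Finset.sum_sub_distrib] at this
    linarith
  have h2 := hc q hqy.mem
  have h3 := Finset.sum_le_sum hle
  -- Optimality of `x` forces equality, hence equality in each coordinate: `x` can replace `y`
  -- beside the same `q`.
  have h4 : ∑ i, (q i * y i - v i (y i)) = ∑ i, (q i * x i - v i (x i)) := by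
    refine le_antisymm h3 ?_
    simp only [Finset.sum_sub_distrib, mul_comm (q _)]
    linarith
  have heq := (Finset.sum_eq_sum_iff_of_le hle).1 h4
  have hxmin : ∀ i, ∀ t ∈ T i, q i * x i - v i (x i) ≤ q i * t - v i t := fun i t ht =>
    (heq i (Finset.mem_univ i)).symm.le.trans ((hqy.mem_argmin i).2 t ht)
  refine ⟨q, hqy.mem, fun i => ?_, fun w hw => ?_⟩
  · exact (convexOnInterval_sub hS i (q i)).mem_argmin (hx i)
      (fun h => hxmin i _ ⟨h, Set.mem_Icc.2 (by omega)⟩)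
      (fun h => hxmin i _ ⟨h, Set.mem_Icc.2 (by omega)⟩)
  · have h5 := hc w hw
    simp only [Finset.sum_sub_distrib, mul_comm (q _)] at h4
    simp only [mul_sub, Finset.sum_sub_distrib]
    linarith

end

/-! ### From integral convexity to midpoint convexity -/

theorem coe_sum_ereal {α : Type*} (s : Finset α) (a : α → ℝ) :
    ((∑ i ∈ s, a i : ℝ) : EReal) = ∑ i ∈ s, (a i : EReal) := by
  classical
  induction s using Finset.induction_on with
  | empty => simp
  | insert i s hi ih => rw [Finset.sum_insert hi, Finset.sum_insert hi, EReal.coe_add, ih]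

section

variable {n : ℕ} {f : (Fin n → ℤ) → EReal}

/-- An affine function that minorizes `f` on `N(x)` minorizes the local convex extension at `x`. -/
theorem le_localConvexExt {x p : Fin n → ℝ} {b : ℝ}
    (h : ∀ w ∈ nbhd x, ((b + ∑ i, p i * (w i : ℝ) : ℝ) : EReal) ≤ f w) :
    ((b + ∑ i, p i * x i : ℝ) : EReal) ≤ localConvexExt f x := by
  refine le_sInf ?_
  rintro _ ⟨c, ⟨hc0, hc1, hcx⟩, rfl⟩
  have h1 : b + ∑ i, p i * x i = ∑ y ∈ nbhd x, c y * (b + ∑ i, p i * (y i : ℝ)) := by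
    simp only [mul_add, Finset.sum_add_distrib, ← Finset.sum_mul, hc1, one_mul, Finset.mul_sum]
    rw [Finset.sum_comm]
    congr 1
    refine Finset.sum_congr rfl fun i _ => ?_
    rw [← hcx i, Finset.mul_sum]
    exact Finset.sum_congr rfl fun y _ => by ring
  rw [h1, coe_sum_ereal]
  refine Finset.sum_le_sum fun y hy => ?_
  rw [EReal.coe_mul]
  exact mul_le_mul_of_nonneg_left (h y hy) (EReal.coe_nonneg.2 (hc0 y hy))

theorem localConvexExt_intCast_le (f : (Fin n → ℤ) → EReal) (z : Fin n → ℤ) :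
    localConvexExt f (fun i => (z i : ℝ)) ≤ f z := by
  have h : nbhd (fun i => (z i : ℝ)) = {z} := by simp [nbhd]
  refine sInf_le ⟨fun _ => 1, ⟨fun _ _ => zero_le_one, by simp [h], fun i => by simp [h]⟩, ?_⟩
  simp [h]

/-- Affine minorants on `nbhd` stand in for the minimum defining the local extension, by weak linear
programming duality. Convexity along the segment from `y` to `z` is used at its midpoint for
`midpoint`, and very near one end for `global`. -/
theorem IsIntegrallyConvex.isMidpointConvex (hf : IsIntegrallyConvex f) {v : (Fin n → ℤ) → ℤ}
    (hv : ∀ x ∈ effDom f, f x = ((v x : ℝ) : EReal)) (htop : ∀ x ∉ effDom f, f x = ⊤) :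
    IsMidpointConvex (effDom f) v := by
  have key : ∀ y ∈ effDom f, ∀ z ∈ effDom f, ∀ ε : ℝ, 0 ≤ ε → ε ≤ 1 → ∀ (p : Fin n → ℤ) (b : ℤ),
      (∀ w ∈ effDom f, (∀ i, |(1 - ε) * y i + ε * z i - w i| < 1) →
        b + ∑ i, p i * w i ≤ v w) →
      (b : ℝ) + ∑ i, (p i : ℝ) * ((1 - ε) * y i + ε * z i) ≤ (1 - ε) * v y + ε * v z := by
    intro y hy z hz ε h0 h1 p b h
    have h2 := le_localConvexExt (f := f)
      (x := (1 - ε) • (fun i => (y i : ℝ)) + ε • fun i => (z i : ℝ))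
      (p := fun i => (p i : ℝ)) (b := b) fun w hw => by
        by_cases hwF : w ∈ effDom f
        · rw [hv w hwF, EReal.coe_le_coe_iff]
          exact_mod_cast h w hwF ((mem_nbhd _ _).1 hw)
        · rw [htop w hwF]
          exact le_top
    have h3 := hf.convex (fun i => (y i : ℝ)) (fun i => (z i : ℝ)) (1 - ε) ε (by linarith) h0
      (by ring)
    have h4 : ((1 - ε : ℝ) : EReal) * localConvexExt f (fun i => (y i : ℝ)) +
        (ε : EReal) * localConvexExt f (fun i => (z i : ℝ)) ≤
        (((1 - ε) * v y + ε * v z : ℝ) : EReal) := by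
      rw [EReal.coe_add, EReal.coe_mul, EReal.coe_mul, ← hv y hy, ← hv z hz]
      exact add_le_add
        (mul_le_mul_of_nonneg_left (localConvexExt_intCast_le f y)
          (EReal.coe_nonneg.2 (by linarith)))
        (mul_le_mul_of_nonneg_left (localConvexExt_intCast_le f z) (EReal.coe_nonneg.2 h0))
    simpa using EReal.coe_le_coe_iff.1 (h2.trans (h3.trans h4))
  constructor
  · intro y hy z hz p b h
    have := key y hy z hz (1 / 2) (by norm_num) (by norm_num) p b fun w hw hwi => h w hw fun i => by
      have h1 : |(2 : ℝ) * w i - (y i + z i)| < 2 := by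
        have := hwi i
        rw [abs_lt] at this ⊢
        constructor <;> linarith
      have h2 : |2 * w i - (y i + z i)| < 2 := by exact_mod_cast h1
      omega
    have h3 : ∑ i, (p i : ℝ) * ((1 - 1 / 2) * y i + 1 / 2 * z i) =
        1 / 2 * ∑ i, (p i : ℝ) * (y i + z i) := by
      rw [Finset.mul_sum]
      exact Finset.sum_congr rfl fun i _ => by ring
    rw [h3] at this
    have h4 : 2 * (b : ℝ) + ∑ i, (p i : ℝ) * (y i + z i) ≤ v y + v z := by linarith
    exact_mod_cast h4
  · intro q hq p h w hw
    -- The step 1 / (1 + R) moves each coordinate by less than 1, so the integral neighbours of the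
    -- new point differ from `q` by less than 2, hence by at most 1.
    set R : ℝ := ∑ i, |(w i : ℝ) - q i| with hR
    have hR0 : 0 ≤ R := Finset.sum_nonneg fun i _ => abs_nonneg _
    have hε : 0 < 1 / (1 + R) := by positivity
    have hε1 : 1 / (1 + R) ≤ 1 := by
      rw [div_le_one (by positivity)]
      linarith
    have := key q hq w hw (1 / (1 + R)) hε.le hε1 p (v q - ∑ i, p i * q i) fun z hz hzi => by
      have h1 := h z hz fun i => by
        have h2 : |1 / (1 + R) * ((w i : ℝ) - q i)| < 1 := by
          rw [abs_mul, abs_of_pos hε, one_div, inv_mul_lt_one₀ (by positivity)]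
          have : |(w i : ℝ) - q i| ≤ R :=
            Finset.single_le_sum (f := fun i => |(w i : ℝ) - q i|)
              (fun i _ => abs_nonneg _) (Finset.mem_univ i)
          linarith
        have h3 : |(z i : ℝ) - q i| < 2 := by
          have := hzi i
          rw [abs_lt] at this h2 ⊢
          constructor <;> linarith
        have h4 : |z i - q i| < 2 := by exact_mod_cast h3
        omega
      simp only [mul_sub, Finset.sum_sub_distrib] at h1
      linarith
    set ε := 1 / (1 + R)
    have h3 : ∑ i, (p i : ℝ) * ((1 - ε) * q i + ε * w i) =
        ∑ i, (p i : ℝ) * q i + ε * ∑ i, (p i : ℝ) * (w i - q i) := by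
      rw [Finset.mul_sum, ← Finset.sum_add_distrib]
      exact Finset.sum_congr rfl fun i _ => by ring
    rw [h3] at this
    push_cast at this
    have h4 : ε * ((v q : ℝ) + ∑ i, (p i : ℝ) * (w i - q i)) ≤ ε * v w := by linarith
    have h5 := le_of_mul_le_mul_left h4 hε
    exact_mod_cast h5

end

/-! ### Attainment and integer data -/

/-- A finite supremum of integers is attained. -/
theorem IsIntOrBot.exists_eq_iSup {α : Type*} {a : α → EReal} (ha : IsIntOrBot a)
    (hfin : IsFinite (⨆ i, a i)) : ∃ i, a i = ⨆ i, a i := by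
  obtain ⟨j, hj⟩ : ∃ j, a j ≠ ⊥ := by
    by_contra! h
    exact hfin.1 (by simp [h])
  obtain ⟨k, hk⟩ := (ha j).resolve_left hj
  obtain ⟨r, hr⟩ : ∃ r : ℝ, (r : EReal) = ⨆ i, a i :=
    ⟨_, EReal.coe_toReal hfin.2 hfin.1⟩
  obtain ⟨m, ⟨i, hi⟩, hmax⟩ := Int.exists_greatest_of_bdd
    (P := fun m => ∃ i, a i = ((m : ℝ) : EReal))
    ⟨⌊r⌋, by
      rintro z ⟨i, hi⟩
      have := le_iSup a i
      rw [hi, ← hr, EReal.coe_le_coe_iff] at this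
      exact Int.le_floor.2 this⟩ ⟨k, j, hk⟩
  refine ⟨i, le_antisymm (le_iSup a i) (iSup_le fun l => ?_)⟩
  rcases ha l with hl | ⟨z, hl⟩
  · simp [hl]
  · rw [hl, hi, EReal.coe_le_coe_iff]
    exact_mod_cast hmax z ⟨l, hl⟩

/-- A finite infimum of integers is attained. -/
theorem IsIntOrTop.exists_eq_iInf {α : Type*} {a : α → EReal} (ha : IsIntOrTop a)
    (hfin : IsFinite (⨅ i, a i)) : ∃ i, a i = ⨅ i, a i := by
  have h : (⨆ i, -a i) = -⨅ i, a i := by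
    refine le_antisymm (iSup_le fun i => EReal.neg_le_neg_iff.2 (iInf_le a i)) ?_
    rw [EReal.neg_le]
    exact le_iInf fun i => EReal.neg_le.1 (le_iSup (fun i => -a i) i)
  obtain ⟨i, hi⟩ := IsIntOrBot.exists_eq_iSup (a := fun i => -a i)
    (fun i => (ha i).imp (by simp +contextual) fun ⟨k, hk⟩ => ⟨-k, by simp [hk]⟩)
    (by
      rw [h]
      exact ⟨by simpa using hfin.2, by simpa using hfin.1⟩)
  exact ⟨i, by simpa [h] using hi⟩

theorem exists_integer_values_of_isIntOrTop {α : Type*} {f : α → EReal} (hf : IsIntOrTop f) :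
    ∃ v : α → ℤ, (∀ x ∈ effDom f, f x = ((v x : ℝ) : EReal)) ∧ ∀ x ∉ effDom f, f x = ⊤ := by
  have h : ∀ x, ∃ k : ℤ, x ∈ effDom f → f x = ((k : ℝ) : EReal) := by
    intro x
    rcases hf x with hx | ⟨k, hk⟩
    · exact ⟨0, fun h => absurd hx h.2.ne⟩
    · exact ⟨k, fun _ => hk⟩
  choose v hv using h
  refine ⟨v, hv, fun x hx => (hf x).resolve_right ?_⟩
  rintro ⟨k, hk⟩
  exact hx (by simp [effDom, hk, EReal.bot_lt_coe, EReal.coe_lt_top])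

theorem exists_integer_values_of_isIntOrBot {α : Type*} {f : α → EReal} (hf : IsIntOrBot f) :
    ∃ v : α → ℤ, (∀ x ∈ effDom f, f x = ((v x : ℝ) : EReal)) ∧ ∀ x ∉ effDom f, f x = ⊥ := by
  have h : ∀ x, ∃ k : ℤ, x ∈ effDom f → f x = ((k : ℝ) : EReal) := by
    intro x
    rcases hf x with hx | ⟨k, hk⟩
    · exact ⟨0, fun h => absurd hx h.1.ne'⟩
    · exact ⟨k, fun _ => hk⟩
  choose v hv using h
  refine ⟨v, hv, fun x hx => (hf x).resolve_right ?_⟩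
  rintro ⟨k, hk⟩
  exact hx (by simp [effDom, hk, EReal.bot_lt_coe, EReal.coe_lt_top])

theorem IsUnivariateConcave.convexOnInterval {ψ : ℤ → EReal} (h : IsUnivariateConcave ψ)
    {u : ℤ → ℤ} (hu : ∀ t ∈ effDom ψ, ψ t = ((u t : ℝ) : EReal)) :
    ConvexOnInterval (effDom ψ) (fun t => - u t) where
  ordConnected := h.dom_interval
  midpoint k hk hk' := by
    have h1 := h.concave k
    rw [hu _ hk, hu _ hk', hu k (h.dom_interval.out hk hk' ⟨by omega, by omega⟩)] at h1
    rw [show (2 : EReal) = ((2 : ℝ) : EReal) from rfl, ← EReal.coe_mul, ← EReal.coe_add,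
      EReal.coe_le_coe_iff] at h1
    have h3 : u (k - 1) + u (k + 1) ≤ 2 * u k := by exact_mod_cast h1
    linarith

/-- An integer-valued separable concave function in terms of integer data. -/
theorem IsSeparableConcave.exists_integer_data {n : ℕ} {Ψ : (Fin n → ℤ) → EReal}
    (h : IsSeparableConcave Ψ) : ∃ (S : Fin n → Set ℤ) (u : Fin n → ℤ → ℤ),
      (∀ i, ConvexOnInterval (S i) (fun t => - u i t)) ∧
      (∀ x, (∀ i, x i ∈ S i) → Ψ x = (((∑ i, u i (x i) : ℤ) : ℝ) : EReal)) ∧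
      ∀ x, (¬ ∀ i, x i ∈ S i) → Ψ x = ⊥ := by
  obtain ⟨ψ, hψ, hΨ⟩ := h
  choose u hu hbot using fun i => exists_integer_values_of_isIntOrBot (hψ i).int_valued
  refine ⟨fun i => effDom (ψ i), u, fun i => (hψ i).convexOnInterval (hu i), fun x hx => ?_,
    fun x hx => ?_⟩
  · rw [hΨ, Int.cast_sum, coe_sum_ereal]
    exact Finset.sum_congr rfl fun i _ => hu i _ (hx i)
  · push Not at hx
    obtain ⟨i, hi⟩ := hx
    rw [hΨ, ← Finset.add_sum_erase _ _ (Finset.mem_univ i), hbot i _ hi, EReal.bot_add]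

/-! ### Conjugates and biconjugacy -/

section

variable {n : ℕ} {f : (Fin n → ℤ) → EReal} {v : (Fin n → ℤ) → ℤ} {p : Fin n → ℤ}

/-- Comparison with an integer bound makes sense even where the conjugate is infinite, and gives the
form in which the dual pair lemmas take their hypotheses. -/
theorem conj_le_intCast_iff (hv : ∀ x ∈ effDom f, f x = ((v x : ℝ) : EReal))
    (htop : ∀ x ∉ effDom f, f x = ⊤) (d : ℤ) :
    conj f p ≤ ((d : ℝ) : EReal) ↔ ∀ q ∈ effDom f, ∑ i, p i * q i - v q ≤ d := by
  rw [conj, iSup_le_iff]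
  refine forall_congr' fun q => ?_
  by_cases hq : q ∈ effDom f
  · rw [hv q hq, pairing, ← EReal.coe_sub, EReal.coe_le_coe_iff]
    simp only [hq, true_imp_iff]
    norm_cast
  · simp [hq, htop q hq]

theorem le_conj (f : (Fin n → ℤ) → EReal) (p q : Fin n → ℤ) : pairing p q - f q ≤ conj f p :=
  le_iSup (fun x => pairing p x - f x) q

theorem concaveConj_le (f : (Fin n → ℤ) → EReal) (p q : Fin n → ℤ) :
    concaveConj f p ≤ pairing p q - f q :=
  iInf_le (fun x => pairing p x - f x) q

theorem pairing_comm (p q : Fin n → ℤ) : pairing p q = pairing q p := by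
  simp only [pairing, mul_comm]

theorem isIntOrBot_pairing_sub (hf : IsIntOrTop f) (p : Fin n → ℤ) :
    IsIntOrBot fun x => pairing p x - f x := fun x => by
  rcases hf x with h | ⟨k, h⟩
  · exact .inl (by simp [h])
  · exact .inr ⟨∑ i, p i * x i - k, by simp only [h, pairing, ← EReal.coe_sub]; norm_cast⟩

theorem isIntOrTop_pairing_sub (hf : IsIntOrBot f) (p : Fin n → ℤ) :
    IsIntOrTop fun x => pairing p x - f x := fun x => by
  rcases hf x with h | ⟨k, h⟩
  · exact .inl (by simp only [h, pairing, EReal.coe_sub_bot])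
  · exact .inr ⟨∑ i, p i * x i - k, by simp only [h, pairing, ← EReal.coe_sub]; norm_cast⟩

theorem conj_ne_bot (hf : (effDom f).Nonempty) (p : Fin n → ℤ) : conj f p ≠ ⊥ := by
  obtain ⟨q, hq⟩ := hf
  refine ne_bot_of_le_ne_bot ?_ (le_conj f p q)
  rw [← EReal.coe_toReal hq.2.ne hq.1.ne', pairing, ← EReal.coe_sub]
  exact EReal.coe_ne_bot _

theorem concaveConj_ne_top (hf : (effDom f).Nonempty) (p : Fin n → ℤ) : concaveConj f p ≠ ⊤ := by
  obtain ⟨q, hq⟩ := hf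
  refine ne_top_of_le_ne_top ?_ (concaveConj_le f p q)
  rw [← EReal.coe_toReal hq.2.ne hq.1.ne', pairing, ← EReal.coe_sub]
  exact EReal.coe_ne_top _

theorem isIntOrTop_conj (hf : IsIntOrTop f) (hne : (effDom f).Nonempty) : IsIntOrTop (conj f) := by
  intro p
  by_cases h : conj f p = ⊤
  · exact .inl h
  · obtain ⟨q, hq⟩ := (isIntOrBot_pairing_sub hf p).exists_eq_iSup ⟨conj_ne_bot hne p, h⟩
    have h1 : pairing p q - f q = conj f p := hq
    rcases isIntOrBot_pairing_sub hf p q with h2 | ⟨k, h2⟩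
    · exact absurd (h1.symm.trans h2) (conj_ne_bot hne p)
    · exact .inr ⟨k, h1.symm.trans h2⟩

theorem isIntOrBot_concaveConj (hf : IsIntOrBot f) (hne : (effDom f).Nonempty) :
    IsIntOrBot (concaveConj f) := by
  intro p
  by_cases h : concaveConj f p = ⊥
  · exact .inl h
  · obtain ⟨q, hq⟩ := (isIntOrTop_pairing_sub hf p).exists_eq_iInf ⟨h, concaveConj_ne_top hne p⟩
    have h1 : pairing p q - f q = concaveConj f p := hq
    rcases isIntOrTop_pairing_sub hf p q with h2 | ⟨k, h2⟩
    · exact absurd (h1.symm.trans h2) (concaveConj_ne_top hne p)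
    · exact .inr ⟨k, h1.symm.trans h2⟩

/-- Integral biconjugacy of integer-valued integrally convex functions. -/
theorem conj_conj (hf : IsIntOrTop f) (hfc : IsIntegrallyConvex f)
    (hdom : (effDom (conj f)).Nonempty) : conj (conj f) = f := by
  obtain ⟨v, hv, htop⟩ := exists_integer_values_of_isIntOrTop hf
  have hmid := hfc.isMidpointConvex hv htop
  have hg := isIntOrTop_conj hf hfc.dom_nonempty
  have hle := fun p d => conj_le_intCast_iff (p := p) hv htop d
  ext1 q
  apply le_antisymm
  · refine iSup_le fun x => EReal.sub_le_of_le_add ?_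
    by_cases hq : q ∈ effDom f
    · rw [pairing_comm, add_comm]
      exact (EReal.sub_le_iff_le_add (.inl hq.1.ne') (.inl hq.2.ne)).1 (le_conj f x q)
    · rw [htop q hq, EReal.top_add_of_ne_bot (conj_ne_bot hfc.dom_nonempty x)]
      exact le_top
  · by_cases h : conj (conj f) q = ⊤
    · simp [h]
    obtain ⟨x, hx⟩ := (isIntOrBot_pairing_sub hg q).exists_eq_iSup ⟨conj_ne_bot hdom q, h⟩
    replace hx : pairing q x - conj f x = conj (conj f) q := hx
    rcases hg x with hc | ⟨c, hc⟩
    · rw [hc, EReal.sub_top] at hx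
      exact absurd hx.symm (conj_ne_bot hdom q)
    -- With linear Ψ = ⟨q, ·⟩ on all of ℤⁿ, the argmin of `(q' i - q i) * t` is nonempty only for
    -- `q' = q`. This also shows that `q` lies in the domain of `f`.
    obtain ⟨q', hq'⟩ := exists_isDualPair_of_minimizer hmid hfc.dom_nonempty
      (S := fun _ => Set.univ) (v := fun i t => q i * t) (x := x) (c := c)
      (fun i => ⟨Set.ordConnected_univ, fun k _ _ => by linarith⟩) (fun i => trivial)
      ((hle x c).1 hc.le)
      (fun y _ d hd => by
        have h1 := (hle y d).2 hd
        have h2 : pairing q y - ((d : ℝ) : EReal) ≤ pairing q x - ((c : ℝ) : EReal) := by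
          rw [← hc, hx]
          exact (EReal.sub_le_sub le_rfl h1).trans (le_conj _ _ _)
        rw [pairing, pairing, ← EReal.coe_sub, ← EReal.coe_sub, EReal.coe_le_coe_iff] at h2
        have h3 : ∑ i, q i * y i - d ≤ ∑ i, q i * x i - c := by exact_mod_cast h2
        linarith)
    obtain rfl : q' = q := by
      ext i
      have h1 := (hq'.mem_argmin i).2 (x i + 1) trivial
      have h2 := (hq'.mem_argmin i).2 (x i - 1) trivial
      linarith
    have h1 := (hle x (∑ i, x i * q' i - v q')).2 fun w hw => by
      have := hq'.subgradient w hw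
      simp only [mul_sub, Finset.sum_sub_distrib] at this
      linarith
    rw [hc, EReal.coe_le_coe_iff] at h1
    have h2 : c ≤ ∑ i, x i * q' i - v q' := by exact_mod_cast h1
    rw [hv q' hq'.mem, ← hx, hc, pairing, ← EReal.coe_sub, EReal.coe_le_coe_iff]
    simp only [mul_comm (q' _)]
    have h3 : v q' ≤ ∑ i, x i * q' i - c := by linarith
    exact_mod_cast h3

end

/-! ### Weak duality and concave conjugates -/

variable {n : ℕ} {g Ψ f : (Fin n → ℤ) → EReal} {v : (Fin n → ℤ) → ℤ} {S : Fin n → Set ℤ}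
  {u : Fin n → ℤ → ℤ}

/-- Weak duality. -/
theorem concaveConj_sub_conj_le (hg : ∀ x, g x ≠ ⊥) (hΨ : ∀ x, Ψ x ≠ ⊤) (x p : Fin n → ℤ) :
    concaveConj Ψ p - conj g p ≤ g x - Ψ x := by
  refine (EReal.sub_le_sub (concaveConj_le Ψ p x) (le_conj g p x)).trans ?_
  rcases eq_or_ne (g x) ⊤ with hgx | hgx
  · simp [hgx, EReal.top_sub (hΨ x)]
  rcases eq_or_ne (Ψ x) ⊥ with hΨx | hΨx
  · simp [hΨx, EReal.sub_bot (hg x)]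
  rw [← EReal.coe_toReal hgx (hg x), ← EReal.coe_toReal (hΨ x) hΨx, pairing]
  simp only [← EReal.coe_sub, EReal.coe_le_coe_iff]
  linarith

theorem le_concaveConj_iff
    (hu : ∀ x, (∀ i, x i ∈ S i) → Ψ x = (((∑ i, u i (x i) : ℤ) : ℝ) : EReal))
    (hbot : ∀ x, (¬ ∀ i, x i ∈ S i) → Ψ x = ⊥) (p : Fin n → ℤ) (c : ℤ) :
    ((c : ℝ) : EReal) ≤ concaveConj Ψ p ↔
      ∀ x : Fin n → ℤ, (∀ i, x i ∈ S i) → c ≤ ∑ i, (p i * x i - u i (x i)) := by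
  rw [concaveConj, le_iInf_iff]
  refine forall_congr' fun x => ?_
  by_cases hx : ∀ i, x i ∈ S i
  · rw [hu x hx, pairing, ← EReal.coe_sub, EReal.coe_le_coe_iff, Finset.sum_sub_distrib]
    simp only [hx, implies_true, true_imp_iff]
    norm_cast
  · simp only [hbot x hx, hx, pairing, EReal.coe_sub_bot, le_top, false_imp_iff]

theorem concaveConj_eq_of_mem_argmin
    (hu : ∀ x, (∀ i, x i ∈ S i) → Ψ x = (((∑ i, u i (x i) : ℤ) : ℝ) : EReal))
    (hbot : ∀ x, (¬ ∀ i, x i ∈ S i) → Ψ x = ⊥) {p x : Fin n → ℤ}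
    (hx : ∀ i, x i ∈ argmin (S i) (fun t => p i * t - u i t)) :
    concaveConj Ψ p = (((∑ i, (p i * x i - u i (x i)) : ℤ) : ℝ) : EReal) := by
  apply le_antisymm
  · refine (concaveConj_le Ψ p x).trans_eq ?_
    rw [hu x fun i => (hx i).1, pairing, ← EReal.coe_sub, Finset.sum_sub_distrib]
    norm_cast
  · rw [le_concaveConj_iff hu hbot]
    exact fun y hy => Finset.sum_le_sum fun i _ => (hx i).2 _ (hy i)

/-- If the concave conjugate is finite at `p`, the infimum is attained in each coordinate. -/
theorem exists_mem_argmin_of_concaveConj_ne_bot (hint : IsIntOrBot Ψ)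
    (hne : (effDom Ψ).Nonempty)
    (hu : ∀ x, (∀ i, x i ∈ S i) → Ψ x = (((∑ i, u i (x i) : ℤ) : ℝ) : EReal))
    (hbot : ∀ x, (¬ ∀ i, x i ∈ S i) → Ψ x = ⊥) {p : Fin n → ℤ} (hp : concaveConj Ψ p ≠ ⊥) :
    ∃ x : Fin n → ℤ, ∀ i, x i ∈ argmin (S i) (fun t => p i * t - u i t) := by
  obtain ⟨x, hx⟩ := (isIntOrTop_pairing_sub hint p).exists_eq_iInf ⟨hp, concaveConj_ne_top hne p⟩
  replace hx : pairing p x - Ψ x = concaveConj Ψ p := hx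
  have hxS : ∀ i, x i ∈ S i := by
    by_contra h
    rw [hbot x h, pairing, EReal.coe_sub_bot] at hx
    exact concaveConj_ne_top hne p hx.symm
  have hle := (le_concaveConj_iff hu hbot p (∑ i, (p i * x i - u i (x i)))).1 (by
    rw [← hx, hu x hxS, pairing, ← EReal.coe_sub, Finset.sum_sub_distrib]
    norm_cast)
  refine ⟨x, fun i => ⟨hxS i, fun a ha => ?_⟩⟩
  -- Changing one coordinate splits the joint minimum into coordinatewise minima.
  have h1 := hle (Function.update x i a) fun j => by
    rcases eq_or_ne j i with rfl | h
    · simpa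
    · simpa [h] using hxS j
  rw [← Finset.add_sum_erase _ _ (Finset.mem_univ i),
    ← Finset.add_sum_erase _ _ (Finset.mem_univ i), Function.update_self] at h1
  have h2 : ∑ j ∈ Finset.univ.erase i, (p j * Function.update x i a j -
      u j (Function.update x i a j)) = ∑ j ∈ Finset.univ.erase i, (p j * x j - u j (x j)) :=
    Finset.sum_congr rfl fun j hj => by rw [Function.update_of_ne (Finset.ne_of_mem_erase hj)]
  linarith

end IntConvex

/-! ### The min-max theorem -/

open IntConvex in
theorem mainTheorem5 (n : ℕ) (g Ψ : (Fin n → ℤ) → EReal)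
    (hg : g ∈ IntConvex.conjClass n) (hg_dom : (IntConvex.effDom g).Nonempty)
    (hΨ : IntConvex.IsSeparableConcave Ψ) (hΨ_dom : (IntConvex.effDom Ψ).Nonempty)
    (hfin : IntConvex.IsFinite (⨅ x : Fin n → ℤ, (g x - Ψ x)) ∨
      IntConvex.IsFinite (⨆ p : Fin n → ℤ, (IntConvex.concaveConj Ψ p - IntConvex.conj g p))) :
    ∃ m : ℤ,
      IsLeast (Set.range fun x : Fin n → ℤ => g x - Ψ x) ((m : ℝ) : EReal) ∧
      IsGreatest (Set.range fun p : Fin n → ℤ =>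
        IntConvex.concaveConj Ψ p - IntConvex.conj g p) ((m : ℝ) : EReal) := by
  obtain ⟨f, hf, hfc, rfl⟩ := hg
  rw [conj_conj hf hfc hg_dom] at *
  obtain ⟨v, hv, htop⟩ := exists_integer_values_of_isIntOrTop hf
  have hmid := hfc.isMidpointConvex hv htop
  have hg := isIntOrTop_conj hf hfc.dom_nonempty
  have hle := fun p d => conj_le_intCast_iff (p := p) hv htop d
  obtain ⟨S, u, hconv, hu, hbot⟩ := hΨ.exists_integer_data
  have hΨint : IsIntOrBot Ψ := fun x => by
    by_cases hx : ∀ i, x i ∈ S i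
    · exact .inr ⟨_, hu x hx⟩
    · exact .inl (hbot x hx)
  have hweak : ∀ x p, concaveConj Ψ p - f p ≤ conj f x - Ψ x := fun x p => by
    have := concaveConj_sub_conj_le (Ψ := Ψ) (conj_ne_bot hfc.dom_nonempty)
      (fun x h => by rcases hΨint x with h' | ⟨k, h'⟩ <;> simp [h] at h') x p
    rwa [conj_conj hf hfc hg_dom] at this
  -- A finite infimum provides a primal minimizer; a finite supremum makes the dual feasible and
  -- bounded.
  obtain ⟨q, x, hqx⟩ : ∃ q x, IsDualPair (effDom f) v S u q x := by
    rcases hfin with hfin | hfin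
    · obtain ⟨x, hx⟩ := IsIntOrTop.exists_eq_iInf (a := fun x => conj f x - Ψ x)
        (fun x => by
          rcases hg x with h | ⟨k, h⟩ <;> rcases hΨint x with h' | ⟨l, h'⟩
          · exact .inl (by simp [h, h'])
          · exact .inl (by simp [h, h'])
          · exact .inl (by simp only [h, h', EReal.coe_sub_bot])
          · exact .inr ⟨k - l, by simp only [h, h']; norm_cast⟩) hfin
      have hxS : ∀ i, x i ∈ S i := by
        by_contra h
        rw [hbot x h, EReal.sub_bot (conj_ne_bot hfc.dom_nonempty x)] at hx
        exact hfin.2 hx.symm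
      rcases hg x with hc | ⟨c, hc⟩
      · rw [hc, hu x hxS, EReal.top_sub_coe] at hx
        exact absurd hx.symm hfin.2
      obtain ⟨q, hq⟩ := exists_isDualPair_of_minimizer hmid hfc.dom_nonempty hconv hxS
        ((hle x c).1 hc.le) fun y hy d hd => by
          have h1 := (iInf_le (fun x => conj f x - Ψ x) y).trans
            (EReal.sub_le_sub ((hle y d).2 hd) le_rfl)
          rw [← hx, hc, hu x hxS, hu y hy, ← EReal.coe_sub, ← EReal.coe_sub,
            EReal.coe_le_coe_iff] at h1
          exact_mod_cast h1
      exact ⟨q, x, hq⟩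
    · have hD : IsIntOrBot fun p => concaveConj Ψ p - f p := fun p => by
        rcases isIntOrBot_concaveConj hΨint hΨ_dom p with h | ⟨k, h⟩ <;>
          rcases hf p with h' | ⟨l, h'⟩
        · exact .inl (by simp [h, h'])
        · exact .inl (by simp [h])
        · exact .inl (by simp [h'])
        · exact .inr ⟨k - l, by simp only [h, h']; norm_cast⟩
      obtain ⟨q, hq⟩ := hD.exists_eq_iSup hfin
      replace hq : concaveConj Ψ q - f q = _ := hq
      obtain ⟨B, hB⟩ := (hD q).resolve_left (fun h => hfin.1 (hq.symm.trans h))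
      replace hB : concaveConj Ψ q - f q = _ := hB
      refine exists_isDualPair_of_bounded hmid hconv ⟨q, ?_, ?_⟩ B fun p hp x hx => ?_
      · by_contra h
        rw [htop q h, EReal.sub_top] at hq
        exact hfin.1 hq.symm
      · obtain ⟨x, hx⟩ := exists_mem_argmin_of_concaveConj_ne_bot hΨint hΨ_dom hu hbot
          (p := q) (fun h => by
            rw [h, EReal.bot_sub] at hq
            exact hfin.1 hq.symm)
        exact fun i => ⟨x i, hx i⟩
      · have h1 := le_iSup (fun p => concaveConj Ψ p - f p) p
        rw [← hq, hB] at h1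
        rw [concaveConj_eq_of_mem_argmin hu hbot hx, hv p hp, ← EReal.coe_sub,
          EReal.coe_le_coe_iff] at h1
        exact_mod_cast h1
  have h1 : concaveConj Ψ q - f q =
      ((∑ i, (q i * x i - u i (x i)) - v q : ℤ) : ℝ) := by
    rw [concaveConj_eq_of_mem_argmin hu hbot hqx.mem_argmin, hv q hqx.mem, ← EReal.coe_sub]
    norm_cast
  -- The subgradient inequality bounds `conj f x` by ⟨x, q⟩ - f(q), so the primal value at `x` is at
  -- most the dual value at `q`.
  have h2 : conj f x - Ψ x ≤ ((∑ i, (q i * x i - u i (x i)) - v q : ℤ) : ℝ) := by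
    have := (hle x (∑ i, x i * q i - v q)).2 fun w hw => by
      have := hqx.subgradient w hw
      simp only [mul_sub, Finset.sum_sub_distrib] at this
      linarith
    refine (EReal.sub_le_sub this le_rfl).trans_eq ?_
    rw [hu x fun i => (hqx.mem_argmin i).1, ← EReal.coe_sub, Finset.sum_sub_distrib]
    simp only [mul_comm (q _)]
    norm_cast
    ring
  have h3 := hweak x q
  rw [h1] at h3
  refine ⟨_, ⟨⟨x, le_antisymm h2 h3⟩, ?_⟩, ⟨⟨q, h1⟩, ?_⟩⟩
  · rintro _ ⟨y, rfl⟩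
    exact h1 ▸ hweak y q
  · rintro _ ⟨p, rfl⟩
    exact (hweak x p).trans h2
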